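/- **Setting.** $(X,d,\mathfrak m)$ is a metric measure space: $(X,d)$ is a complete separable metric space, and $\mathfrak m$ is a non-null Borel measure, finite on bounded sets, with $\int e^{-c\,d^2(x,x_0)}\,d\mathfrak m(x)<\infty$ for some $c>0$ and $x_0\in X$. $\mathscr P_{ac}(X)$ is the set of Borel probability measures $\mu\ll\mathfrak m$ with $\int d^2(x,x_0)\,d\mu(x)<\infty$. For a distance $\delta$ on $X$ inducing the topology of $X$, $\mathrm{OptPlans}_\delta(\mu,\nu)$ is the set of minimizers of $\int\delta^2\,d\pi$ among couplings $\pi$ of $\mu,\nu$, and $(W_2^\delta)^2(\mu,\nu)$ is the infimum. A curve $\gamma\in C([0,1],X)$ is a constant speed $\delta$-geodesic if $\delta(\gamma_s,\gamma_t)=|s-t|\,\delta(\gamma_0,\gamma_1)$ for all $s,t\in[0,1]$. Write $e_t(\gamma)=\gamma_t$, and let $\mathrm{restr}_s^t\gamma$ be the curve $r\mapsto\gamma_{(1-r)s+rt}$. Let $\mathrm{Ent}(\rho\,\mathfrak m)=\int\rho\log\rho\,d\mathfrak m$, and $\mathrm{Ent}(\mu)=+\infty$ if $\mu\not\ll\mathfrak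 m$. For $K\in\mathbb R$ and a probability $\eta$ on $C([0,1],X)$ with time marginals $\mu_t=(e_t)_\#\eta$, the entropy is *$K$-convex along $\eta$ with respect to $\delta$* if for all $t\in[0,1]$ $$\mathrm{Ent}(\mu_t)\le(1-t)\,\mathrm{Ent}(\mu_0)+t\,\mathrm{Ent}(\mu_1)-\tfrac K2\,t(1-t)\,(W_2^\delta)^2(\mu_0,\mu_1),$$ with $0\cdot\infty=0$. A Borel map $G:X\times X\to C([0,1],X)$ is a *consistent geodesic flow* for $\delta$ if for all $x,y$ the curve $G(x,y)$ is a constant speed $\delta$-geodesic from $x$ to $y$, and $\mathrm{restr}_s^tG(x,y)=G\big(G(x,y)(s),G(x,y)(t)\big)$ for all $s<t$ in $(0,1)$. It is *Lipschitz* for $\delta$ if for some $L$ one has $\delta\big(G(x_1,y_1)(t),G(x_2,y_2)(t)\big)\le L\,(\delta^2(x_1,x_2)+\delta^2(y_1,y_2))^{1/2}$ for all points and all $t\in[0,1]$. Put $G_t=e_t\circ G$. A map $\Pi:\mathscr P_{ac}(X)\times\mathscr P_{ac}(X)\to\mathscr P(X\times X)$ is a *consistent plan selection* on $(X,d,\mathfrak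 m)$ associated to $G$ if for all $\mu,\nu\in\mathscr P_{ac}(X)$: (1) $\Pi(\mu,\nu)\in\mathrm{OptPlans}_d(\mu,\nu)$; (2) for all $s<t$ in $[0,1]$ and all bounded Borel $f:X\times X\to[0,\infty)$ with $\int f\,d\Pi(\mu,\nu)=1$, if $\mu'=(G_s)_\#(f\,\Pi(\mu,\nu))$ and $\nu'=(G_t)_\#(f\,\Pi(\mu,\nu))$ both belong to $\mathscr P_{ac}(X)$, then $(G_s,G_t)_\#(f\,\Pi(\mu,\nu))=\Pi(\mu',\nu')$. $(X,d,\mathfrak m)$ is a *very strict $\mathsf{CD}(K,\infty)$ space* if for all $\mu_0,\mu_1\in\mathscr P_{ac}(X)$ there is a probability measure $\eta$ on $C([0,1],X)$, concentrated on constant speed $d$-geodesics, with $(e_0,e_1)_\#\eta\in\mathrm{OptPlans}_d(\mu_0,\mu_1)$, such that for all $t_0<t_1$ in $[0,1]$ and all bounded Borel $f\ge0$ with $\int f\,d\eta=1$ the entropy is $K$-convex along $(\mathrm{restr}_{t_0}^{t_1})_\#(f\eta)$ with respect to $d$. **Proposition.** Let $(X,d,\mathfrak m)$ be a locally compact metric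 measure space, let $K\in\mathbb R$, and let $(d_n)_{n\in\mathbb N}$ be distances on $X$ inducing the same topology as $d$, converging to $d$ locally uniformly on $X\times X$, such that for some constant $H$ one has $d_n(x,y)\le H\,d(x,y)$ for all $x,y\in X$ and all $n$. Assume that there is a map $G:X\times X\to C([0,1],X)$ which is a Lipschitz consistent geodesic flow for $d$ and a consistent geodesic flow for every $d_n$. Suppose that there is a consistent plan selection $\Pi$ on $(X,d,\mathfrak m)$ associated to $G$ such that for every $\mu,\nu\in\mathscr P_{ac}(X)$ there is a sequence $\pi_n\in\mathrm{OptPlans}_{d_n}(\mu,\nu)$ satisfying 1. $\pi_n\rightharpoonup\Pi(\mu,\nu)$ weakly along some subsequence; 2. for every $n$, the entropy is $K$-convex along $G_\#\pi_n$ with respect to $d_n$. Then $(X,d,\mathfrak m)$ is a very strict $\mathsf{CD}(K,\infty)$ space. -/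

import Mathlib

open MeasureTheory Filter Topology
open scoped unitInterval ENNReal NNReal

noncomputable section

namespace VeryStrictCD

variable {X : Type*}

/-! ## Curves -/

/-- The space `C([0,1], X)` (with the compact-open topology, i.e. the topology of uniform
convergence) carries its Borel σ-algebra. -/
instance instMeasurableSpaceCurves [TopologicalSpace X] : MeasurableSpace C(I, X) := borel _

instance instBorelSpaceCurves [TopologicalSpace X] : BorelSpace C(I, X) := ⟨rfl⟩

/-- The evaluation map `e_t : C([0,1], X) → X`. -/
def ev [TopologicalSpace X] (t : I) (γ : C(I, X)) : X := γ t

/-- The restriction map `restr_s^t`: the curve `r ↦ γ ((1 - r) s + r t)`. -/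
def restr [TopologicalSpace X] (s t : I) (γ : C(I, X)) : C(I, X) :=
  γ.comp ⟨fun r => Set.Icc.convexComb s t r, Set.Icc.continuous_convexComb s t⟩

/-- `δ` is a distance on `X` which induces the given topology of `X`. -/
structure IsCompatibleDist [TopologicalSpace X] (δ : X → X → ℝ) : Prop where
  self_eq_zero : ∀ x, δ x x = 0
  eq_of_eq_zero : ∀ x y, δ x y = 0 → x = y
  symm : ∀ x y, δ x y = δ y x
  triangle : ∀ x y z, δ x z ≤ δ x y + δ y z
  isOpen_iff : ∀ U : Set X, IsOpen U ↔ ∀ x ∈ U, ∃ ε > 0, ∀ y, δ x y < ε → y ∈ U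

/-- `γ` is a constant speed geodesic (an element of `Geo(X)`) for the distance `δ`. -/
def IsGeo [TopologicalSpace X] (δ : X → X → ℝ) (γ : C(I, X)) : Prop :=
  ∀ s t : I, δ (γ s) (γ t) = |(s : ℝ) - (t : ℝ)| * δ (γ 0) (γ 1)

/-- `G` is a consistent geodesic flow for the distance `δ`. -/
structure IsConsistentGeodesicFlow [TopologicalSpace X] [MeasurableSpace X]
    (δ : X → X → ℝ) (G : X × X → C(I, X)) : Prop where
  measurable : Measurable G
  isGeo : ∀ x y, IsGeo δ (G (x, y))
  start : ∀ x y, G (x, y) 0 = x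
  finish : ∀ x y, G (x, y) 1 = y
  consistent : ∀ (x y : X) (s t : I), 0 < s → s < t → t < 1 →
    restr s t (G (x, y)) = G (G (x, y) s, G (x, y) t)

/-- `G` is `L`-Lipschitz from `X × X` with the `ℓ²` product distance to the curves with the
sup distance. -/
def IsLipschitzFlow [TopologicalSpace X]
    (δ : X → X → ℝ) (L : ℝ) (G : X × X → C(I, X)) : Prop :=
  ∀ (x₁ y₁ x₂ y₂ : X) (t : I),
    δ (G (x₁, y₁) t) (G (x₂, y₂) t) ≤ L * Real.sqrt (δ x₁ x₂ ^ 2 + δ y₁ y₂ ^ 2)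

/-- The map `G_t = e_t ∘ G : X × X → X`. -/
def flowAt [TopologicalSpace X] (G : X × X → C(I, X)) (t : I) (p : X × X) : X := ev t (G p)

/-! ## Optimal transport for the cost `δ²` -/

/-- The total cost `∫ δ(x,y)² dπ(x,y)`. -/
def cost [MeasurableSpace X] (δ : X → X → ℝ) (π : Measure (X × X)) : ℝ≥0∞ :=
  ∫⁻ p, ENNReal.ofReal (δ p.1 p.2 ^ 2) ∂π

/-- The transport plans between `μ` and `ν`. -/
def plans [MeasurableSpace X] (μ ν : Measure X) : Set (Measure (X × X)) :=
  {π | π.map Prod.fst = μ ∧ π.map Prod.snd = ν}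

/-- The squared Wasserstein distance `W₂²(μ, ν)` relative to `δ`. -/
def W2sq [MeasurableSpace X] (δ : X → X → ℝ) (μ ν : Measure X) : ℝ≥0∞ :=
  ⨅ π ∈ plans μ ν, cost δ π

/-- The optimal transport plans between `μ` and `ν` for the cost `δ²`. -/
def optPlans [MeasurableSpace X] (δ : X → X → ℝ) (μ ν : Measure X) : Set (Measure (X × X)) :=
  {π | π ∈ plans μ ν ∧ ∀ π' ∈ plans μ ν, cost δ π ≤ cost δ π'}

/-- `η` is an optimal geodesic plan between `μ` and `ν`: it is concentrated on constant speed
geodesics and `(e₀, e₁)_# η` is an optimal plan. -/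
def IsOptGeo [TopologicalSpace X] [MeasurableSpace X] (δ : X → X → ℝ) (μ ν : Measure X)
    (η : Measure C(I, X)) : Prop :=
  (∀ᵐ γ ∂η, IsGeo δ γ) ∧ η.map (fun γ => (ev 0 γ, ev 1 γ)) ∈ optPlans δ μ ν

/-! ## Entropy -/

/-- The relative entropy `Ent_m(μ) = ∫ ρ log ρ dm` if `μ = ρ m`, and `+∞` if `μ` is not absolutely
continuous. The integral is the integral of the positive part minus that of the negative part,
so it is `+∞` when only the positive part has infinite integral. -/
def Ent [MeasurableSpace X] (m μ : Measure X) : EReal :=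
  open Classical in
  if μ ≪ m then
    ((∫⁻ x, ENNReal.ofReal ((μ.rnDeriv m x).toReal * Real.log (μ.rnDeriv m x).toReal) ∂m :
        ℝ≥0∞) : EReal) -
    ((∫⁻ x, ENNReal.ofReal (-((μ.rnDeriv m x).toReal * Real.log (μ.rnDeriv m x).toReal)) ∂m :
        ℝ≥0∞) : EReal)
  else ⊤

/-- The `K`-convexity inequality of the entropy along the curve of measures `t ↦ (e_t)_# η`,
with respect to the distance `δ`. -/
def EntKConvexAlong [TopologicalSpace X] [MeasurableSpace X] (δ : X → X → ℝ) (m : Measure X)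
    (K : ℝ) (η : Measure C(I, X)) : Prop :=
  ∀ t : I, Ent m (η.map (ev t)) ≤
    ((1 - (t : ℝ) : ℝ) : EReal) * Ent m (η.map (ev 0)) +
      ((t : ℝ) : EReal) * Ent m (η.map (ev 1)) -
      ((K / 2 * (t : ℝ) * (1 - (t : ℝ)) : ℝ) : EReal) *
        ((W2sq δ (η.map (ev 0)) (η.map (ev 1)) : ℝ≥0∞) : EReal)

/-! ## Metric measure spaces -/

/-- The conditions on the reference measure of a metric measure space: `m` is non-null, finite on
bounded sets, and `∫ exp(-c d(x, x₀)²) dm(x) < ∞` for some `c > 0` and some `x₀`. -/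
structure IsReferenceMeasure [PseudoMetricSpace X] [MeasurableSpace X] (m : Measure X) :
    Prop where
  ne_zero : m ≠ 0
  finite_on_bounded : ∀ s : Set X, Bornology.IsBounded s → m s < ⊤
  growth : ∃ c : ℝ, 0 < c ∧ ∃ x₀ : X,
    ∫⁻ x, ENNReal.ofReal (Real.exp (-(c * dist x x₀ ^ 2))) ∂m < ⊤

/-- `P_ac(X)`: the probability measures with finite second moment which are absolutely continuous
with respect to `m`. -/
def Pac [PseudoMetricSpace X] [MeasurableSpace X] (m : Measure X) : Set (ProbabilityMeasure X) :=
  {μ | (μ : Measure X) ≪ m ∧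
    ∃ x₀ : X, ∫⁻ x, ENNReal.ofReal (dist x x₀ ^ 2) ∂(μ : Measure X) < ⊤}

/-- The very strict `CD(K, ∞)` condition. The densities `f` are functions on all of `C([0,1], X)`;
as `η` is concentrated on the closed set `Geo(X)`, this is the same as taking bounded Borel
functions on `Geo(X)`. -/
def IsVeryStrictCD [PseudoMetricSpace X] [MeasurableSpace X] (m : Measure X) (K : ℝ) : Prop :=
  ∀ μ₀ ∈ Pac m, ∀ μ₁ ∈ Pac m, ∃ η : ProbabilityMeasure C(I, X),
    IsOptGeo dist (μ₀ : Measure X) (μ₁ : Measure X) (η : Measure C(I, X)) ∧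
    ∀ (t₀ t₁ : I), t₀ < t₁ → ∀ f : C(I, X) → ℝ≥0, Measurable f → (∃ C : ℝ≥0, ∀ γ, f γ ≤ C) →
      ∫⁻ γ, (f γ : ℝ≥0∞) ∂(η : Measure C(I, X)) = 1 →
      EntKConvexAlong dist m K
        (((η : Measure C(I, X)).withDensity fun γ => (f γ : ℝ≥0∞)).map (restr t₀ t₁))

/-- `Sel` is a consistent plan selection on `(X, d, m)` associated to the flow `G`. In the second
condition `μ'` and `ν'` are the measures `(G_s)_# (f Sel(μ, ν))` and `(G_t)_# (f Sel(μ, ν))`, which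
are required to belong to `P_ac(X)`. -/
structure IsConsistentPlanSelection [PseudoMetricSpace X] [MeasurableSpace X] (m : Measure X)
    (G : X × X → C(I, X)) (Sel : Pac m → Pac m → ProbabilityMeasure (X × X)) : Prop where
  optimal : ∀ μ ν : Pac m,
    (Sel μ ν : Measure (X × X)) ∈ optPlans dist (μ.1 : Measure X) (ν.1 : Measure X)
  consistent : ∀ (μ ν : Pac m) (s t : I), s < t →
    ∀ f : X × X → ℝ≥0, Measurable f → (∃ C : ℝ≥0, ∀ p, f p ≤ C) →
      ∫⁻ p, (f p : ℝ≥0∞) ∂(Sel μ ν : Measure (X × X)) = 1 →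
      ∀ μ' ν' : Pac m,
        ((Sel μ ν : Measure (X × X)).withDensity fun p => (f p : ℝ≥0∞)).map (flowAt G s)
          = (μ'.1 : Measure X) →
        ((Sel μ ν : Measure (X × X)).withDensity fun p => (f p : ℝ≥0∞)).map (flowAt G t)
          = (ν'.1 : Measure X) →
        ((Sel μ ν : Measure (X × X)).withDensity fun p => (f p : ℝ≥0∞)).map
            (fun p => (flowAt G s p, flowAt G t p))
          = (Sel μ' ν' : Measure (X × X))

end VeryStrictCD

end

namespace VeryStrictCD

/-! ## The dual formula for the Kullback-Leibler divergence -/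

section Duality

open InformationTheory

/-! The witness is `η = G_# Π(μ₀, μ₁)`, and there are two independent steps.

Stability (`entKConvexAlong_of_tendsto`): `K`-convexity along `G_# πₙ` passes to `G_# Π(μ, ν)`. All
plans share the marginals `μ`, `ν`, so the endpoint entropies do not move and `q(x, y) = d²(x, x₀) +
d²(y, x₀)` has the same integral under every plan. Since `q` dominates `dₙ²` and `d²(G_t, x₀)` up to
constants, the costs and the second moments at time `t` converge
(`tendsto_integral_of_tendstoLocallyUniformly`). As `m` may be infinite, the entropy is rewritten as
a Kullback-Leibler divergence relative to the finite measure `e^{-c d²} m`, plus a constant, minus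
`c` times the second moment (`Ent_eq_klDiv_add`). The divergence is lower semicontinuous because it
is a supremum over bounded continuous test functions (`integral_sub_integral_exp_le_toReal_klDiv`,
`klDiv_le_of_forall_boundedContinuous`).

Selection (`isVeryStrictCD_of_consistentPlanSelection`): by consistency of flow and plans, weighting
and restricting `η` gives `G_# Π(μ', ν')` for the new endpoints, to which stability applies. If an
endpoint is not absolutely continuous, the upper bound is `+∞`. -/

lemma mul_sub_exp_sub_one_le_klFun {r : ℝ} (hr : 0 ≤ r) (a : ℝ) :
    r * a - (Real.exp a - 1) ≤ klFun r := by
  rw [klFun_apply]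
  rcases hr.eq_or_lt with rfl | hr
  · have := Real.exp_pos a
    simp only [zero_mul]
    linarith
  -- Young's inequality: `exp a - 1` is the convex conjugate of `klFun`, and equality holds at `a =
  -- log r`, where the tangent to `exp` is taken.
  · have h := Real.add_one_le_exp (a - Real.log r)
    rw [Real.exp_sub, Real.exp_log hr, le_div_iff₀ hr] at h
    nlinarith

lemma exp_sub_exp_le_mul_abs {a b N : ℝ} (ha : a ≤ N) :
    Real.exp a - Real.exp b ≤ Real.exp N * |a - b| := by
  have h := Real.add_one_le_exp (b - a)
  rw [Real.exp_sub, le_div_iff₀ (Real.exp_pos a)] at h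
  calc Real.exp a - Real.exp b ≤ Real.exp a * (a - b) := by linarith
    _ ≤ Real.exp a * |a - b| := by gcongr; exact le_abs_self _
    _ ≤ Real.exp N * |a - b| := by gcongr

variable {Y : Type*} [MeasurableSpace Y] {μ ν : Measure Y} [IsFiniteMeasure μ] [IsFiniteMeasure ν]

/-- Easy half of the duality: integrate Young's inequality against `ν`, with `r` the density of `μ`
and `a = g`. -/
lemma integral_sub_integral_exp_le_toReal_klDiv (h : klDiv μ ν ≠ ∞) {g : Y → ℝ}
    (hg : Measurable g) {N : ℝ} (hN : ∀ x, |g x| ≤ N) :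
    ∫ x, g x ∂μ - ∫ x, (Real.exp (g x) - 1) ∂ν ≤ (klDiv μ ν).toReal := by
  obtain ⟨hac, hint⟩ := klDiv_ne_top_iff.1 h
  have hgμ : Integrable g μ := .of_bound hg.aestronglyMeasurable N (ae_of_all _ hN)
  have hexp : Integrable (fun x => Real.exp (g x) - 1) ν := by
    refine (Integrable.of_bound hg.exp.aestronglyMeasurable (Real.exp N)
      (ae_of_all _ fun x => ?_)).sub (integrable_const 1)
    rw [Real.norm_eq_abs, Real.abs_exp]
    exact Real.exp_le_exp.2 ((le_abs_self _).trans (hN x))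
  have hrg : Integrable (fun x => (μ.rnDeriv ν x).toReal * g x) ν := by
    simpa only [smul_eq_mul] using (integrable_rnDeriv_smul_iff hac).2 hgμ
  rw [toReal_klDiv_eq_integral_klFun hac,
    show ∫ x, g x ∂μ = ∫ x, (μ.rnDeriv ν x).toReal * g x ∂ν by
      simpa only [smul_eq_mul] using (integral_rnDeriv_smul (f := g) hac).symm,
    ← integral_sub hrg hexp]
  exact integral_mono (hrg.sub hexp) ((integrable_klFun_rnDeriv_iff hac).2 hint)
    fun x => mul_sub_exp_sub_one_le_klFun ENNReal.toReal_nonneg _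

/-- Bounded continuous functions are dense in `L¹(μ + ν)`, so one approximation serves both
integrals; `exp` is Lipschitz on the bounded range of the functions. -/
lemma integral_sub_integral_exp_le_of_measurable [TopologicalSpace Y]
    [TopologicalSpace.PseudoMetrizableSpace Y] [BorelSpace Y] {C : ℝ}
    (h : ∀ g : BoundedContinuousFunction Y ℝ,
      ∫ x, g x ∂μ - ∫ x, (Real.exp (g x) - 1) ∂ν ≤ C)
    {g : Y → ℝ} (hg : Measurable g) {N : ℝ} (hN : ∀ x, |g x| ≤ N) :
    ∫ x, g x ∂μ - ∫ x, (Real.exp (g x) - 1) ∂ν ≤ C := by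
  have integrable_of_bound (ρ : Measure Y) [IsFiniteMeasure ρ] (u : Y → ℝ) (hu : Measurable u)
      (M : ℝ) (hM : ∀ x, |u x| ≤ M) : Integrable u ρ :=
    .of_bound hu.aestronglyMeasurable M (ae_of_all _ hM)
  have integrable_exp (u : Y → ℝ) (hu : Measurable u) (hM : ∀ x, |u x| ≤ N) :
      Integrable (fun x => Real.exp (u x)) ν :=
    integrable_of_bound ν _ hu.exp (Real.exp N) fun x => by
      rw [Real.abs_exp]
      exact Real.exp_le_exp.2 ((le_abs_self _).trans (hM x))
  refine le_of_forall_pos_le_add fun ε hε => ?_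
  -- The total error is at most `ε'` in the first integral and `exp N * ε'` in the second.
  set ε' : ℝ := ε / (1 + Real.exp N) with hε'
  have hpos : 0 < 1 + Real.exp N := by positivity
  obtain ⟨f, hf, hfint⟩ := (integrable_of_bound (μ + ν) g hg N hN).exists_boundedContinuous_integral_sub_le
    (show 0 < ε' by positivity)
  -- Clipping to `[-N, N]` keeps continuity and does not increase the distance to `g`, which already
  -- takes values there.
  let w : Y → ℝ := fun x => max (-N) (min N (f x))
  have hwc : Continuous w := by fun_prop
  have hwN (x : Y) : |w x| ≤ N := by
    have : 0 ≤ N := (abs_nonneg _).trans (hN x)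
    exact abs_le.2 ⟨le_max_left _ _, max_le (by linarith) (min_le_left _ _)⟩
  have hgw (x : Y) : |g x - w x| ≤ |g x - f x| := by
    have h1 : g x = max (-N) (min N (g x)) := by
      rw [min_eq_right (abs_le.1 (hN x)).2, max_eq_right (abs_le.1 (hN x)).1]
    have h2 := abs_max_sub_max_le_max (-N) (min N (g x)) (-N) (min N (f x))
    have h3 := abs_min_sub_min_le_max N (g x) N (f x)
    rw [sub_self, abs_zero, max_eq_right (abs_nonneg (_ : ℝ))] at h2 h3
    rw [← h1] at h2
    exact h2.trans h3
  have hdint : Integrable (fun x => |g x - w x|) (μ + ν) :=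
    ((integrable_of_bound _ g hg N hN).sub
      (integrable_of_bound _ w hwc.measurable N hwN)).abs
  have hd : ∫ x, |g x - w x| ∂(μ + ν) ≤ ε' :=
    (integral_mono hdint ((integrable_of_bound _ g hg N hN).sub hfint).norm hgw).trans hf
  have hdμ : Integrable (fun x => |g x - w x|) μ := hdint.left_of_add_measure
  have hdν : Integrable (fun x => |g x - w x|) ν := hdint.right_of_add_measure
  rw [integral_add_measure hdμ hdν] at hd
  have h0μ : 0 ≤ ∫ x, |g x - w x| ∂μ := integral_nonneg fun x => abs_nonneg _
  have h0ν : 0 ≤ ∫ x, |g x - w x| ∂ν := integral_nonneg fun x => abs_nonneg _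
  have hmain := h (BoundedContinuousFunction.ofNormedAddCommGroup w hwc N hwN)
  simp only [BoundedContinuousFunction.coe_ofNormedAddCommGroup] at hmain
  have h1 : ∫ x, g x ∂μ - ∫ x, w x ∂μ ≤ ∫ x, |g x - w x| ∂μ := by
    rw [← integral_sub (integrable_of_bound _ g hg N hN)
      (integrable_of_bound _ w hwc.measurable N hwN)]
    exact integral_mono ((integrable_of_bound _ g hg N hN).sub
      (integrable_of_bound _ w hwc.measurable N hwN)) hdμ fun x => le_abs_self _
  have hew : Integrable (fun x => Real.exp (w x) - 1) ν :=
    (integrable_exp w hwc.measurable hwN).sub (integrable_const (1 : ℝ))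
  have heg : Integrable (fun x => Real.exp (g x) - 1) ν :=
    (integrable_exp g hg hN).sub (integrable_const (1 : ℝ))
  have h2 : ∫ x, (Real.exp (w x) - 1) ∂ν - ∫ x, (Real.exp (g x) - 1) ∂ν
      ≤ Real.exp N * ∫ x, |g x - w x| ∂ν := by
    rw [← integral_sub hew heg, ← integral_const_mul]
    refine integral_mono (hew.sub heg) (hdν.const_mul _) fun x => ?_
    have := exp_sub_exp_le_mul_abs (b := g x) ((le_abs_self _).trans (hwN x))
    rw [abs_sub_comm] at this
    simpa using this
  have h3 : ε' * (1 + Real.exp N) = ε := div_mul_cancel₀ _ hpos.ne'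
  nlinarith [Real.exp_pos N]

/-- With `T` the clipped value, the expression is `klFun T + (r - T) * log T`. The last product is
nonnegative: clipping happens only when `r ≤ T ≤ 1` or `r ≥ T ≥ 1`. This sign is what permits
Fatou's lemma below. -/
lemma mul_log_clip_sub_nonneg {r k : ℝ} (hr : 0 ≤ r) (hk : 1 ≤ k) :
    0 ≤ r * Real.log (max k⁻¹ (min k r)) - (max k⁻¹ (min k r) - 1) := by
  have hk0 : 0 < k := by linarith
  have hkinv : k⁻¹ ≤ 1 := inv_le_one_of_one_le₀ hk
  have key {s : ℝ} (hs : 0 < s) : 0 ≤ s * Real.log s - (s - 1) := by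
    have := klFun_nonneg hs.le
    rw [klFun_apply] at this
    linarith
  rcases le_total r k with h | h
  · rw [min_eq_right h]
    rcases le_total r k⁻¹ with h' | h'
    · rw [max_eq_left h']
      have := key (inv_pos.2 hk0)
      have hlog : Real.log k⁻¹ ≤ 0 := Real.log_nonpos (inv_pos.2 hk0).le hkinv
      nlinarith
    · rw [max_eq_right h']
      exact key ((inv_pos.2 hk0).trans_le h')
  · rw [min_eq_left h, max_eq_right (hkinv.trans hk)]
    have := key hk0
    have hlog := Real.log_nonneg hk
    nlinarith

/-- Hard half of the duality: the optimal test function is the logarithm of the density, which is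
truncated to be bounded and then recovered by Fatou. -/
lemma klDiv_le_of_forall_boundedContinuous [TopologicalSpace Y]
    [TopologicalSpace.PseudoMetrizableSpace Y] [BorelSpace Y] {C : ℝ}
    (h : ∀ g : BoundedContinuousFunction Y ℝ,
      ∫ x, g x ∂μ - ∫ x, (Real.exp (g x) - 1) ∂ν ≤ C) :
    klDiv μ ν ≤ ENNReal.ofReal C := by
  have h' {g : Y → ℝ} (hg : Measurable g) {N : ℝ} (hN : ∀ x, |g x| ≤ N) :=
    integral_sub_integral_exp_le_of_measurable h hg hN
  have hac : μ ≪ ν := by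
    refine Measure.AbsolutelyContinuous.mk fun s hs hs0 => ?_
    -- On a `ν`-null set `s` the test function `n · 1_s` costs nothing, so `n * μ s` stays bounded
    -- in `n`.
    have hmul (n : ℕ) : (n : ℝ) * μ.real s ≤ C := by
      have h1 := h' (g := s.indicator fun _ => (n : ℝ)) (measurable_const.indicator hs) (N := n)
        fun x => by
          by_cases hx : x ∈ s <;> simp [hx]
      have h2 : ∫ x, (Real.exp (s.indicator (fun _ => (n : ℝ)) x) - 1) ∂ν = 0 := by
        refine integral_eq_zero_of_ae ?_
        filter_upwards [measure_eq_zero_iff_ae_notMem.1 hs0] with x hx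
        simp [hx]
      rw [h2, integral_indicator_const _ hs, smul_eq_mul, sub_zero, mul_comm] at h1
      exact h1
    have : μ.real s ≤ 0 := by
      by_contra! hpos
      obtain ⟨n, hn⟩ := exists_nat_gt (C / μ.real s)
      rw [div_lt_iff₀ hpos] at hn
      exact absurd (hmul n) (not_le.2 hn)
    exact (measureReal_eq_zero_iff).1 (le_antisymm this measureReal_nonneg)
  rw [klDiv_eq_lintegral_klFun_of_ac hac]
  set r : Y → ℝ := fun x => (μ.rnDeriv ν x).toReal with hr
  have hrm : Measurable r := (Measure.measurable_rnDeriv μ ν).ennreal_toReal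
  let T : ℕ → Y → ℝ := fun n x => max ((n : ℝ) + 1)⁻¹ (min ((n : ℝ) + 1) (r x))
  have hTm (n : ℕ) : Measurable (T n) := by fun_prop
  have hn1 (n : ℕ) : (1 : ℝ) ≤ (n : ℝ) + 1 := by simp
  have hTpos (n : ℕ) (x : Y) : 0 < T n x :=
    (by positivity : (0 : ℝ) < ((n : ℝ) + 1)⁻¹).trans_le (le_max_left _ _)
  have hTle (n : ℕ) (x : Y) : T n x ≤ (n : ℝ) + 1 :=
    max_le ((inv_le_one_of_one_le₀ (hn1 n)).trans (hn1 n)) (min_le_left _ _)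
  have hTlog (n : ℕ) (x : Y) : |Real.log (T n x)| ≤ Real.log ((n : ℝ) + 1) := by
    refine abs_le.2 ⟨?_, Real.log_le_log (hTpos n x) (hTle n x)⟩
    rw [← Real.log_inv]
    exact Real.log_le_log (by positivity) (le_max_left _ _)
  have hbound (n : ℕ) :
      ∫⁻ x, ENNReal.ofReal (r x * Real.log (T n x) - (T n x - 1)) ∂ν ≤ ENNReal.ofReal C := by
    have hlogμ : Integrable (fun x => Real.log (T n x)) μ :=
      .of_bound (hTm n).log.aestronglyMeasurable _ (ae_of_all _ (hTlog n))
    have h1 : Integrable (fun x => r x * Real.log (T n x)) ν := by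
      simpa only [smul_eq_mul] using (integrable_rnDeriv_smul_iff hac).2 hlogμ
    have h2 : Integrable (fun x => T n x - 1) ν := by
      refine (Integrable.of_bound (hTm n).aestronglyMeasurable ((n : ℝ) + 1)
        (ae_of_all _ fun x => ?_)).sub (integrable_const 1)
      rw [Real.norm_eq_abs, abs_of_pos (hTpos n x)]
      exact hTle n x
    have h12 : Integrable (fun x => r x * Real.log (T n x) - (T n x - 1)) ν := h1.sub h2
    rw [← ofReal_integral_eq_lintegral_ofReal h12
      (ae_of_all _ fun x => mul_log_clip_sub_nonneg ENNReal.toReal_nonneg (hn1 n))]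
    refine ENNReal.ofReal_le_ofReal ?_
    have h3 := h' (hTm n).log (hTlog n)
    simp only [Real.exp_log (hTpos n _)] at h3
    rw [integral_sub h1 h2]
    rwa [← integral_rnDeriv_smul hac] at h3
  have hlim (x : Y) : Tendsto (fun n => ENNReal.ofReal (r x * Real.log (T n x) - (T n x - 1)))
      atTop (𝓝 (ENNReal.ofReal (klFun (r x)))) := by
    refine ENNReal.tendsto_ofReal ?_
    have hr0 : 0 ≤ r x := ENNReal.toReal_nonneg
    rcases hr0.eq_or_lt with h0 | hpos
    · have hT (n : ℕ) : T n x = ((n : ℝ) + 1)⁻¹ := by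
        simp only [T, ← h0]
        rw [min_eq_right (by positivity), max_eq_left (by positivity)]
      simp only [← h0, hT, klFun_zero, zero_mul, zero_sub, neg_sub]
      simpa [one_div] using (tendsto_one_div_add_atTop_nhds_zero_nat (𝕜 := ℝ)).const_sub 1
    · have hev : ∀ᶠ n : ℕ in atTop, T n x = r x := by
        have e1 : Tendsto (fun n : ℕ => (n : ℝ) + 1) atTop atTop :=
          tendsto_atTop_add_const_right _ _ tendsto_natCast_atTop_atTop
        filter_upwards [e1.eventually_ge_atTop (r x),
          (tendsto_inv_atTop_zero.comp e1).eventually_le_const hpos] with n hn1 hn2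
        simp only [T]
        rw [min_eq_right hn1]
        exact max_eq_right hn2
      refine tendsto_const_nhds.congr' ?_
      filter_upwards [hev] with n hn
      rw [hn, klFun_apply]
      ring
  calc ∫⁻ x, ENNReal.ofReal (klFun (r x)) ∂ν
      = ∫⁻ x, liminf (fun n => ENNReal.ofReal (r x * Real.log (T n x) - (T n x - 1))) atTop ∂ν :=
        lintegral_congr fun x => (hlim x).liminf_eq.symm
    _ ≤ liminf (fun n => ∫⁻ x, ENNReal.ofReal (r x * Real.log (T n x) - (T n x - 1)) ∂ν) atTop :=
        lintegral_liminf_le fun n =>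
          ((hrm.mul (hTm n).log).sub ((hTm n).sub_const 1)).ennreal_ofReal
    _ ≤ ENNReal.ofReal C := by
        refine (liminf_le_liminf (Eventually.of_forall hbound)).trans ?_
        simp

end Duality

/-! ## The entropy relative to an infinite reference measure -/

section Entropy

open InformationTheory

/-- Change of reference measure at the level of integrands: `r` is the density relative to `m`, and
`exp a * r` the one relative to `e^{-a} m`. -/
lemma exp_neg_mul_klFun {r : ℝ} (hr : 0 ≤ r) (a : ℝ) :
    Real.exp (-a) * klFun (Real.exp a * r) = r * Real.log r + r * a + Real.exp (-a) - r := by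
  have he : Real.exp (-a) * Real.exp a = 1 := by rw [← Real.exp_add]; simp
  rw [klFun_apply]
  rcases hr.eq_or_lt with rfl | hr
  · simp
  · rw [Real.log_mul (Real.exp_pos a).ne' hr.ne', Real.log_exp]
    linear_combination (r * (a + Real.log r) - r) * he

/-- The hypothesis is a subtraction-free identity in `ℝ≥0∞`. In the application `A`, `B` are the
positive and negative parts of the entropy, `k` the divergence, `a` the integral of `φ`, `b` the
mass of the new reference measure, and `1` the mass of `μ`. -/
lemma coe_sub_coe_eq_of_add_eq {k A B : ℝ≥0∞} {a b : ℝ} (ha : 0 ≤ a) (hb : 0 ≤ b) (hB : B ≠ ∞)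
    (h : k + B + 1 = A + ENNReal.ofReal a + ENNReal.ofReal b) :
    (A : EReal) - (B : EReal) = (k : EReal) + ((1 - b - a : ℝ) : EReal) := by
  lift B to ℝ≥0 using hB
  rcases eq_or_ne A ∞ with rfl | hA
  · have hk : k = ∞ := by
      by_contra hk
      have : k + B + 1 ≠ ∞ := by finiteness
      exact this (by rw [h]; simp)
    subst hk
    rw [EReal.coe_ennreal_top, EReal.top_add_coe, sub_eq_add_neg]
    exact EReal.top_add_of_ne_bot (by simp)
  · have hk : k ≠ ∞ := by
      rintro rfl
      have : A + ENNReal.ofReal a + ENNReal.ofReal b ≠ ∞ := by finiteness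
      exact this (by rw [← h]; simp)
    have h' := congrArg ENNReal.toReal h
    rw [ENNReal.toReal_add (by finiteness) (by simp), ENNReal.toReal_add hk (by simp),
      ENNReal.toReal_add (by finiteness) (by simp), ENNReal.toReal_add hA (by simp),
      ENNReal.toReal_ofReal ha, ENNReal.toReal_ofReal hb] at h'
    rw [← EReal.coe_ennreal_toReal hA, ← EReal.coe_ennreal_toReal hk,
      ← EReal.coe_ennreal_toReal (x := (B : ℝ≥0∞)) (by simp)]
    norm_cast
    simp only [ENNReal.toReal_one] at h'
    linarith

variable {Y : Type*} [MeasurableSpace Y] {m μ : Measure Y} {φ : Y → ℝ}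

lemma Ent_eq_klDiv_add [SigmaFinite m] [IsProbabilityMeasure μ] (hφ : Measurable φ)
    (hφ0 : ∀ x, 0 ≤ φ x) (hφμ : Integrable φ μ)
    [IsFiniteMeasure (m.withDensity fun x => ENNReal.ofReal (Real.exp (-φ x)))] :
    Ent m μ = (klDiv μ (m.withDensity fun x => ENNReal.ofReal (Real.exp (-φ x))) : EReal) +
      ((1 - (m.withDensity fun x => ENNReal.ofReal (Real.exp (-φ x))).real Set.univ
        - ∫ x, φ x ∂μ : ℝ) : EReal) := by
  set E : Y → ℝ≥0∞ := fun x => ENNReal.ofReal (Real.exp (-φ x)) with hE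
  have hEm : Measurable E := by fun_prop
  have hE0 (x : Y) : E x ≠ 0 := by simp [hE, Real.exp_pos]
  have hEtop (x : Y) : E x ≠ ∞ := ENNReal.ofReal_ne_top
  have hmν : m ≪ m.withDensity E :=
    withDensity_absolutelyContinuous' hEm.aemeasurable (ae_of_all _ hE0)
  have hνm : m.withDensity E ≪ m := withDensity_absolutelyContinuous _ _
  by_cases hac : μ ≪ m
  swap
  · rw [klDiv_of_not_ac fun h => hac (h.trans hνm), Ent, if_neg hac, EReal.coe_ennreal_top,
      EReal.top_add_coe]
  rw [Ent, if_pos hac]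
  set r : Y → ℝ := fun x => (μ.rnDeriv m x).toReal with hr
  have hrm : Measurable r := (Measure.measurable_rnDeriv μ m).ennreal_toReal
  have hr0 (x : Y) : 0 ≤ r x := ENNReal.toReal_nonneg
  have hrfin : ∀ᵐ x ∂m, ENNReal.ofReal (r x) = μ.rnDeriv m x := by
    filter_upwards [μ.rnDeriv_lt_top m] with x hx using ENNReal.ofReal_toReal hx.ne
  have hk0 (x : Y) : 0 ≤ r x * Real.log (r x) + r x * φ x + Real.exp (-φ x) - r x := by
    rw [← exp_neg_mul_klFun (hr0 x)]
    exact mul_nonneg (Real.exp_pos _).le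
      (klFun_nonneg (mul_nonneg (Real.exp_pos _).le (hr0 x)))
  have hkl : klDiv μ (m.withDensity E) =
      ∫⁻ x, ENNReal.ofReal (r x * Real.log (r x) + r x * φ x + Real.exp (-φ x) - r x) ∂m := by
    rw [klDiv_eq_lintegral_klFun_of_ac (hac.trans hmν),
      lintegral_withDensity_eq_lintegral_mul _ hEm (by fun_prop)]
    refine lintegral_congr_ae ?_
    filter_upwards [Measure.rnDeriv_withDensity_right μ m hEm.aemeasurable (ae_of_all _ hE0)
      (ae_of_all _ hEtop)] with x hx
    have h1 : (μ.rnDeriv (m.withDensity E) x).toReal = Real.exp (φ x) * r x := by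
      rw [hx, ENNReal.toReal_mul, ENNReal.toReal_inv, ENNReal.toReal_ofReal (Real.exp_pos _).le,
        Real.exp_neg, inv_inv]
    rw [Pi.mul_apply, h1, ← exp_neg_mul_klFun (hr0 x), ENNReal.ofReal_mul (Real.exp_pos _).le]
  have h1 : ∫⁻ x, ENNReal.ofReal (r x) ∂m = 1 := by
    rw [lintegral_congr_ae hrfin, Measure.lintegral_rnDeriv hac, measure_univ]
  have h2 : ∫⁻ x, ENNReal.ofReal (r x * φ x) ∂m = ENNReal.ofReal (∫ x, φ x ∂μ) := by
    rw [ofReal_integral_eq_lintegral_ofReal hφμ (ae_of_all _ hφ0),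
      ← lintegral_rnDeriv_mul hac hφ.ennreal_ofReal.aemeasurable]
    refine lintegral_congr_ae ?_
    filter_upwards [hrfin] with x hx
    rw [ENNReal.ofReal_mul (hr0 x), hx]
  have h3 : ∫⁻ x, E x ∂m = ENNReal.ofReal ((m.withDensity E).real Set.univ) := by
    rw [ofReal_measureReal, withDensity_apply _ MeasurableSet.univ, Measure.restrict_univ]
  refine coe_sub_coe_eq_of_add_eq (integral_nonneg hφ0) measureReal_nonneg ?_ ?_
  -- Nonnegativity of `klFun` bounds the negative part of `r log r` by `r φ + e^{-φ}`, so the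
  -- difference defining the entropy is never `∞ - ∞`.
  · have hle : ∫⁻ x, ENNReal.ofReal (-(r x * Real.log (r x))) ∂m
        ≤ ∫⁻ x, (ENNReal.ofReal (r x * φ x) + E x) ∂m := by
      refine lintegral_mono fun x => ?_
      rw [hE, ← ENNReal.ofReal_add (mul_nonneg (hr0 x) (hφ0 x)) (Real.exp_pos _).le]
      exact ENNReal.ofReal_le_ofReal (by linarith [hk0 x, hr0 x])
    rw [lintegral_add_right _ hEm, h2, h3] at hle
    exact ne_top_of_le_ne_top (by finiteness) hle
  · rw [hkl, ← h1, ← h2, ← h3, ← lintegral_add_left (by fun_prop), ← lintegral_add_left (by fun_prop),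
      ← lintegral_add_left (by fun_prop), ← lintegral_add_left (by fun_prop)]
    refine lintegral_congr fun x => ?_
    have hφr := mul_nonneg (hr0 x) (hφ0 x)
    have he := (Real.exp_pos (-φ x)).le
    rcases le_total 0 (r x * Real.log (r x)) with hs | hs
    · rw [ENNReal.ofReal_of_nonpos (neg_nonpos.2 hs), add_zero, ← ENNReal.ofReal_add (hk0 x) (hr0 x),
        ← ENNReal.ofReal_add hs hφr, ← ENNReal.ofReal_add (by positivity) he]
      congr 1
      ring
    · rw [ENNReal.ofReal_of_nonpos hs, zero_add, ← ENNReal.ofReal_add (hk0 x) (neg_nonneg.2 hs),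
        ← ENNReal.ofReal_add (add_nonneg (hk0 x) (neg_nonneg.2 hs)) (hr0 x),
        ← ENNReal.ofReal_add hφr he]
      congr 1
      ring

end Entropy

/-! ## Convergence of integrals along weakly converging measures -/

/-- No mass of the dominating function `v` escapes to infinity, because its integral is the same
under all the measures. A cutoff `f k` reduces the claim to a compact set, where convergence is
uniform. -/
lemma tendsto_integral_of_tendstoLocallyUniformly {Z : Type*} [TopologicalSpace Z]
    [LocallyCompactSpace Z] [SecondCountableTopology Z] [T2Space Z] [MeasurableSpace Z]
    [BorelSpace Z] {π : ℕ → ProbabilityMeasure Z} {P : ProbabilityMeasure Z}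
    (hπ : Tendsto π atTop (𝓝 P)) {u : ℕ → Z → ℝ} {w v : Z → ℝ} (hu : ∀ n, Continuous (u n))
    (hv : Continuous v) (hlim : TendstoLocallyUniformly u w atTop)
    (huv : ∀ n x, |u n x| ≤ v x) (hvP : Integrable v (P : Measure Z))
    (hvπ : ∀ n, Integrable v (π n : Measure Z))
    (heq : ∀ n, ∫ x, v x ∂(π n : Measure Z) = ∫ x, v x ∂(P : Measure Z)) :
    Tendsto (fun n => ∫ x, u n x ∂(π n : Measure Z)) atTop (𝓝 (∫ x, w x ∂(P : Measure Z))) := by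
  have hw : Continuous w := hlim.continuous (Frequently.of_forall hu)
  have hv0 (x : Z) : 0 ≤ v x := (abs_nonneg _).trans (huv 0 x)
  have hwv (x : Z) : |w x| ≤ v x :=
    le_of_tendsto ((tendstoLocallyUniformlyOn_univ.2 hlim).tendsto_at (Set.mem_univ x)).abs (Eventually.of_forall fun n => huv n x)
  have hex (n : ℕ) : ∃ f : C(Z, ℝ), Set.EqOn f 1 (compactCovering Z n) ∧ HasCompactSupport f ∧
      ∀ x, f x ∈ Set.Icc (0 : ℝ) 1 := by
    obtain ⟨f, h1, -, h2, h3⟩ := exists_continuous_one_zero_of_isCompact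
      (isCompact_compactCovering Z n) isClosed_empty (Set.disjoint_empty _)
    exact ⟨f, h1, h2, h3⟩
  choose f hf1 hfc hf01 using hex
  -- continuous functions with compact support can be integrated to the limit
  have hcs (g : Z → ℝ) (hg : Continuous g) (k : ℕ) :
      Tendsto (fun n => ∫ x, f k x * g x ∂(π n : Measure Z)) atTop
        (𝓝 (∫ x, f k x * g x ∂(P : Measure Z))) := by
    have hc : Continuous fun x => f k x * g x := (f k).continuous.mul hg
    obtain ⟨C, hC⟩ := (hfc k).mul_right (f' := g) |>.exists_bound_of_continuous hc
    exact (ProbabilityMeasure.tendsto_iff_forall_integral_tendsto.1 hπ)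
      (BoundedContinuousFunction.ofNormedAddCommGroup _ hc C hC)
  have htail : Tendsto (fun k => ∫ x, (1 - f k x) * v x ∂(P : Measure Z)) atTop (𝓝 0) := by
    rw [← integral_zero Z ℝ (μ := (P : Measure Z))]
    refine tendsto_integral_of_dominated_convergence v
      (fun k => ((continuous_const.sub (f k).continuous).mul hv).aestronglyMeasurable) hvP
      (fun k => ae_of_all _ fun x => ?_) (ae_of_all _ fun x => ?_)
    · rw [Real.norm_eq_abs, abs_mul, abs_of_nonneg (hv0 x),
        abs_of_nonneg (sub_nonneg.2 (hf01 k x).2)]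
      exact mul_le_of_le_one_left (hv0 x) (by linarith [(hf01 k x).1])
    · refine tendsto_const_nhds.congr' ?_
      obtain ⟨N, hN⟩ := Set.mem_iUnion.1 ((iUnion_compactCovering Z).symm ▸ Set.mem_univ x)
      filter_upwards [eventually_ge_atTop N] with k hk
      rw [hf1 k (compactCovering_subset Z hk hN)]
      simp
  have hint_mul (ρ : ProbabilityMeasure Z) (hρ : Integrable v (ρ : Measure Z)) (g : Z → ℝ)
      (hg : Continuous g) (hgv : ∀ x, |g x| ≤ v x) (h : Z → ℝ) (hh : Continuous h)
      (hh1 : ∀ x, |h x| ≤ 1) : Integrable (fun x => h x * g x) (ρ : Measure Z) := by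
    refine hρ.mono' (hh.mul hg).aestronglyMeasurable (ae_of_all _ fun x => ?_)
    rw [Real.norm_eq_abs, abs_mul]
    exact (mul_le_of_le_one_left (abs_nonneg _) (hh1 x)).trans (hgv x)
  have hf_abs (k : ℕ) (x : Z) : |f k x| ≤ 1 := by
    rw [abs_of_nonneg (hf01 k x).1]; exact (hf01 k x).2
  have hf_abs' (k : ℕ) (x : Z) : |1 - f k x| ≤ 1 := by
    rw [abs_of_nonneg (sub_nonneg.2 (hf01 k x).2)]; linarith [(hf01 k x).1]
  have hsplit (ρ : ProbabilityMeasure Z) (hρ : Integrable v (ρ : Measure Z)) (g : Z → ℝ)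
      (hg : Continuous g) (hgv : ∀ x, |g x| ≤ v x) (k : ℕ) :
      ∫ x, g x ∂(ρ : Measure Z) =
        ∫ x, f k x * g x ∂(ρ : Measure Z) + ∫ x, (1 - f k x) * g x ∂(ρ : Measure Z) := by
    rw [← integral_add (hint_mul ρ hρ g hg hgv _ (f k).continuous (hf_abs k))
      (hint_mul ρ hρ g hg hgv (fun x => 1 - f k x)
        (continuous_const.sub (f k).continuous) (hf_abs' k))]
    exact integral_congr_ae (ae_of_all _ fun x => by ring)
  have htail_le (ρ : ProbabilityMeasure Z) (hρ : Integrable v (ρ : Measure Z)) (g : Z → ℝ)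
      (hgv : ∀ x, |g x| ≤ v x) (k : ℕ) :
      |∫ x, (1 - f k x) * g x ∂(ρ : Measure Z)| ≤ ∫ x, (1 - f k x) * v x ∂(ρ : Measure Z) := by
    refine norm_integral_le_of_norm_le (f := fun x => (1 - f k x) * g x)
      (hint_mul ρ hρ v hv (fun x => (abs_of_nonneg (hv0 x)).le) _
        (continuous_const.sub (f k).continuous) (hf_abs' k)) (ae_of_all _ fun x => ?_)
    rw [Real.norm_eq_abs, abs_mul, abs_of_nonneg (sub_nonneg.2 (hf01 k x).2)]
    exact mul_le_mul_of_nonneg_left (hgv x) (sub_nonneg.2 (hf01 k x).2)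
  rw [Metric.tendsto_atTop']
  intro ε hε
  obtain ⟨k, hk⟩ := (htail.eventually_lt_const (show 0 < ε / 8 by positivity)).exists
  -- The tail of `v` under `π n` is the common integral minus the integral of `f k * v`, which has
  -- compact support and hence passes to the limit.
  have htailn : ∀ᶠ n in atTop, ∫ x, (1 - f k x) * v x ∂(π n : Measure Z) < ε / 8 := by
    have hv_abs (x : Z) : |v x| ≤ v x := (abs_of_nonneg (hv0 x)).le
    refine Tendsto.eventually_lt_const hk ?_
    have h1 := (hcs v hv k).const_sub (∫ x, v x ∂(P : Measure Z))
    rw [show ∫ x, v x ∂(P : Measure Z) - ∫ x, f k x * v x ∂(P : Measure Z) =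
      ∫ x, (1 - f k x) * v x ∂(P : Measure Z) by rw [hsplit P hvP v hv hv_abs k]; ring] at h1
    refine h1.congr fun n => ?_
    rw [← heq n, hsplit (π n) (hvπ n) v hv hv_abs k]
    ring
  have hunif : ∀ᶠ n in atTop, ∀ x ∈ tsupport (f k), |w x - u n x| < ε / 8 := by
    have := (tendstoLocallyUniformly_iff_forall_isCompact.1 hlim) (tsupport (f k)) (hfc k)
    exact Metric.tendstoUniformlyOn_iff.1 this (ε / 8) (by positivity)
  have hfw : ∀ᶠ n in atTop,
      |∫ x, f k x * w x ∂(π n : Measure Z) - ∫ x, f k x * w x ∂(P : Measure Z)| < ε / 8 :=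
    Metric.tendsto_nhds.1 (hcs w hw k) (ε / 8) (by positivity)
  obtain ⟨N, hN⟩ := eventually_atTop.1 ((htailn.and hunif).and hfw)
  refine ⟨N, fun n hn => ?_⟩
  obtain ⟨⟨h1, h2⟩, h3⟩ := hN n hn.le
  rw [Real.dist_eq, hsplit (π n) (hvπ n) (u n) (hu n) (huv n) k, hsplit P hvP w hw hwv k]
  have h4 := (htail_le (π n) (hvπ n) (u n) (huv n) k).trans_lt h1
  have h5 := (htail_le P hvP w hwv k).trans_lt hk
  have h6 : |∫ x, f k x * u n x ∂(π n : Measure Z) - ∫ x, f k x * w x ∂(π n : Measure Z)|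
      ≤ ε / 8 := by
    rw [← integral_sub (hint_mul (π n) (hvπ n) (u n) (hu n) (huv n) _ (f k).continuous (hf_abs k))
      (hint_mul (π n) (hvπ n) w hw hwv _ (f k).continuous (hf_abs k))]
    have := norm_integral_le_of_norm_le_const (μ := (π n : Measure Z)) (C := ε / 8)
      (f := fun x => f k x * u n x - f k x * w x) (ae_of_all _ fun x => ?_)
    · simpa using this
    rw [← mul_sub, Real.norm_eq_abs, abs_mul]
    by_cases hx : x ∈ tsupport (f k)
    · rw [abs_sub_comm]
      exact (mul_le_of_le_one_left (abs_nonneg _) (hf_abs k x)).trans (h2 x hx).le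
    · rw [image_eq_zero_of_notMem_tsupport hx]
      simp only [abs_zero, zero_mul]
      positivity
  rw [abs_lt] at h3 h4 h5 ⊢
  rw [abs_le] at h6
  constructor <;> linarith

/-! ## Compatible distances -/

section CompatibleDist

variable {X : Type*} [TopologicalSpace X] {δ : X → X → ℝ}

lemma IsCompatibleDist.nonneg (h : IsCompatibleDist δ) (x y : X) : 0 ≤ δ x y := by
  have := h.triangle x y x
  rw [h.self_eq_zero, h.symm y x] at this
  linarith

lemma IsCompatibleDist.isOpen_ball (h : IsCompatibleDist δ) (x : X) (r : ℝ) :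
    IsOpen {y | δ x y < r} :=
  (h.isOpen_iff _).2 fun y hy => ⟨r - δ x y, sub_pos.2 hy, fun z hz => by
    have := h.triangle x y z
    change δ x z < r
    linarith [hz]⟩

lemma IsCompatibleDist.continuous (h : IsCompatibleDist δ) :
    Continuous fun p : X × X => δ p.1 p.2 := by
  refine continuous_iff_continuousAt.2 fun ⟨x, y⟩ => Metric.tendsto_nhds.2 fun ε hε => ?_
  have hball (z : X) : ∀ᶠ w in 𝓝 z, δ z w < ε / 2 :=
    (h.isOpen_ball z (ε / 2)).mem_nhds (by simp [h.self_eq_zero, hε])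
  filter_upwards [(hball x).prod_nhds (hball y)] with ⟨a, b⟩ ⟨ha, hb⟩
  simp only [Real.dist_eq, abs_lt] at ha hb ⊢
  have h1 := h.triangle a x b
  have h2 := h.triangle x y b
  have h3 := h.triangle x a y
  have h4 := h.triangle a b y
  rw [h.symm a x] at h1
  rw [h.symm b y] at h4
  constructor <;> linarith

end CompatibleDist

/-! ## Geodesic flows -/

section Flow

variable {X : Type*}

lemma continuous_ev [TopologicalSpace X] (t : I) : Continuous (ev t : C(I, X) → X) :=
  ContinuousEvalConst.continuous_eval_const t

lemma continuous_restr [TopologicalSpace X] (s t : I) :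
    Continuous (restr s t : C(I, X) → C(I, X)) :=
  ContinuousMap.continuous_precomp _

lemma measurableSet_isGeo [PseudoMetricSpace X] :
    MeasurableSet {γ : C(I, X) | IsGeo dist γ} := by
  refine IsClosed.measurableSet ?_
  simp only [IsGeo, Set.ofPred_forall]
  refine isClosed_iInter fun s => isClosed_iInter fun t => isClosed_eq ?_ ?_
  · exact (continuous_ev s).dist (continuous_ev t)
  · exact continuous_const.mul ((continuous_ev 0).dist (continuous_ev 1))

variable [PseudoMetricSpace X] {G : X × X → C(I, X)} {L : ℝ}

lemma IsLipschitzFlow.continuous_flowAt (h : IsLipschitzFlow dist L G) (t : I) :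
    Continuous (flowAt G t) := by
  refine continuous_iff_continuousAt.2 fun p => tendsto_iff_dist_tendsto_zero.2 ?_
  refine squeeze_zero (g := fun q : X × X => L * Real.sqrt (dist q.1 p.1 ^ 2 + dist q.2 p.2 ^ 2))
    (fun q => dist_nonneg) (fun q => h q.1 q.2 p.1 p.2 t) ?_
  have hc : Continuous fun q : X × X => L * Real.sqrt (dist q.1 p.1 ^ 2 + dist q.2 p.2 ^ 2) := by
    fun_prop
  simpa using hc.tendsto p

variable [MeasurableSpace X]

lemma IsConsistentGeodesicFlow.measurable_flowAt [BorelSpace X] {δ : X → X → ℝ}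
    (h : IsConsistentGeodesicFlow δ G) (t : I) : Measurable (flowAt G t) :=
  (continuous_ev t).measurable.comp h.measurable

lemma sq_dist_flowAt_le (h : IsConsistentGeodesicFlow dist G) (hL : IsLipschitzFlow dist L G)
    (t : I) (p : X × X) (x₀ : X) :
    dist (flowAt G t p) x₀ ^ 2 ≤ L ^ 2 * (dist p.1 x₀ ^ 2 + dist p.2 x₀ ^ 2) := by
  -- The geodesic from `x₀` to itself is constant, which makes it a reference curve for the
  -- Lipschitz bound.
  have h0 : dist (G (x₀, x₀) t) x₀ = 0 := by
    have := h.isGeo x₀ x₀ t 0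
    rwa [h.start, h.finish, dist_self, mul_zero] at this
  have h1 : dist (flowAt G t p) x₀ ≤ L * Real.sqrt (dist p.1 x₀ ^ 2 + dist p.2 x₀ ^ 2) := by
    have h2 := dist_triangle (flowAt G t p) (G (x₀, x₀) t) x₀
    rw [h0, add_zero] at h2
    exact h2.trans (hL p.1 p.2 x₀ x₀ t)
  have h3 := pow_le_pow_left₀ dist_nonneg h1 2
  rwa [mul_pow, Real.sq_sqrt (by positivity)] at h3

/-- Consistency is assumed only between interior times. It is used at `a u` and `a (1 - u)`, which
are interior and ordered for `0 < u < 1/2`, and continuity as `u → 0` covers endpoints `0` and `1`.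
-/
lemma restr_flow_eq {X : Type*} [MetricSpace X] [MeasurableSpace X] {G : X × X → C(I, X)}
    (h : IsConsistentGeodesicFlow dist G) (hL : IsLipschitzFlow dist L G) {s t : I} (hst : s < t)
    (p : X × X) : restr s t (G p) = G (flowAt G s p, flowAt G t p) := by
  obtain ⟨x, y⟩ := p
  let a : I → I := fun u => Set.Icc.convexComb s t u
  have ha : Continuous a := Set.Icc.continuous_convexComb s t
  have hb : Continuous fun u => a (unitInterval.symm u) := ha.comp unitInterval.continuous_symm
  ext r
  let lhs : I → X := fun u => G (x, y) (Set.Icc.convexComb (a u) (a (unitInterval.symm u)) r)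
  let rhs : I → X := fun u => flowAt G r (G (x, y) (a u), G (x, y) (a (unitInterval.symm u)))
  have hlhs : Continuous lhs := by
    refine (G (x, y)).continuous.comp (Continuous.subtype_mk (f := fun u => (1 - (r : ℝ)) * (a u : ℝ)
      + r * (a (unitInterval.symm u) : ℝ)) ?_ _)
    fun_prop
  have hrhs : Continuous rhs := (hL.continuous_flowAt r).comp
    (((G (x, y)).continuous.comp ha).prodMk ((G (x, y)).continuous.comp hb))
  have heq : ∀ᶠ u in 𝓝[>] (0 : I), lhs u = rhs u := by
    have hhalf : ∀ᶠ u : I in 𝓝[>] (0 : I), (u : ℝ) < 1 / 2 :=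
      nhdsWithin_le_nhds ((continuous_subtype_val.tendsto (0 : I)).eventually
        (gt_mem_nhds (by norm_num)))
    filter_upwards [hhalf, self_mem_nhdsWithin] with u hu hu0
    have hu0' : (0 : ℝ) < u := hu0
    have hst' : (s : ℝ) < t := hst
    have hs0 := s.2.1
    have ht1 := t.2.2
    have h1 : 0 < a u := by
      rw [← Subtype.coe_lt_coe, Set.Icc.coe_convexComb, Set.Icc.coe_zero]
      nlinarith
    have h2 : a u < a (unitInterval.symm u) := by
      rw [← Subtype.coe_lt_coe, Set.Icc.coe_convexComb, Set.Icc.coe_convexComb,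
        unitInterval.coe_symm_eq]
      nlinarith
    have h3 : a (unitInterval.symm u) < 1 := by
      rw [← Subtype.coe_lt_coe, Set.Icc.coe_convexComb, unitInterval.coe_symm_eq, Set.Icc.coe_one]
      nlinarith
    exact DFunLike.congr_fun (h.consistent x y _ _ h1 h2 h3) r
  have hne : (𝓝[>] (0 : I)).NeBot := nhdsGT_neBot_of_exists_gt ⟨1, zero_lt_one⟩
  have hfin : lhs 0 = rhs 0 := tendsto_nhds_unique_of_eventuallyEq
    ((hlhs.tendsto 0).mono_left nhdsWithin_le_nhds)
    ((hrhs.tendsto 0).mono_left nhdsWithin_le_nhds) heq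
  simp only [lhs, rhs, a, unitInterval.symm_zero, Set.Icc.convexComb_zero,
    Set.Icc.convexComb_one] at hfin
  exact hfin

end Flow

/-! ## Second moments and transport costs -/

section Moments

lemma sq_dist_le {X : Type*} [PseudoMetricSpace X] (x y z : X) : dist x y ^ 2 ≤ 2 * (dist x z ^ 2 + dist y z ^ 2) := by
  have h := pow_le_pow_left₀ dist_nonneg (dist_triangle_right x y z) 2
  nlinarith [sq_nonneg (dist x z - dist y z)]

lemma W2sq_eq_cost {X : Type*} [MeasurableSpace X] {δ : X → X → ℝ} {μ ν : Measure X}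
    {π : Measure (X × X)} (hπ : π ∈ optPlans δ μ ν) : W2sq δ μ ν = cost δ π :=
  le_antisymm (iInf₂_le π hπ.1) (le_iInf₂ hπ.2)

lemma coe_W2sq_eq_integral {X : Type*} [MeasurableSpace X] {δ : X → X → ℝ} {μ ν : Measure X}
    {π : Measure (X × X)} (hπ : π ∈ optPlans δ μ ν)
    (hint : Integrable (fun p : X × X => δ p.1 p.2 ^ 2) π) :
    ((W2sq δ μ ν : ℝ≥0∞) : EReal) = ((∫ p, δ p.1 p.2 ^ 2 ∂π : ℝ) : EReal) := by
  have h0 : 0 ≤ ∫ p, δ p.1 p.2 ^ 2 ∂π := integral_nonneg fun p => sq_nonneg _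
  rw [W2sq_eq_cost hπ, cost, ← ofReal_integral_eq_lintegral_ofReal hint
    (ae_of_all _ fun p => sq_nonneg _), EReal.coe_ennreal_ofReal, max_eq_left h0]

variable {X : Type*} [PseudoMetricSpace X] [MeasurableSpace X]

lemma integrable_sq_dist [BorelSpace X] {μ : Measure X} [IsFiniteMeasure μ]
    (h : ∃ x₁ : X, ∫⁻ x, ENNReal.ofReal (dist x x₁ ^ 2) ∂μ < ∞) (x₀ : X) :
    Integrable (fun x => dist x x₀ ^ 2) μ := by
  obtain ⟨x₁, h⟩ := h
  have h1 : Integrable (fun x => dist x x₁ ^ 2) μ :=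
    (lintegral_ofReal_ne_top_iff_integrable
      (Continuous.measurable (by fun_prop)).aestronglyMeasurable
      (ae_of_all _ fun x => by positivity)).1 h.ne
  refine ((h1.add (integrable_const (dist x₀ x₁ ^ 2))).const_mul 2).mono'
    (Continuous.measurable (by fun_prop)).aestronglyMeasurable (ae_of_all _ fun x => ?_)
  rw [Real.norm_eq_abs, abs_of_nonneg (by positivity)]
  exact sq_dist_le x x₀ x₁

lemma integrable_add_sq_dist {μ ν : Measure X} {π : Measure (X × X)} (hπ : π ∈ plans μ ν) {x₀ : X}
    (hμ : Integrable (fun x => dist x x₀ ^ 2) μ) (hν : Integrable (fun x => dist x x₀ ^ 2) ν) :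
    Integrable (fun p : X × X => dist p.1 x₀ ^ 2 + dist p.2 x₀ ^ 2) π := by
  obtain ⟨h1, h2⟩ := hπ
  subst h1 h2
  exact (hμ.comp_measurable measurable_fst).add (hν.comp_measurable measurable_snd)

lemma integral_add_sq_dist {μ ν : Measure X} {π : Measure (X × X)} (hπ : π ∈ plans μ ν) {x₀ : X}
    (hμ : Integrable (fun x => dist x x₀ ^ 2) μ) (hν : Integrable (fun x => dist x x₀ ^ 2) ν) :
    ∫ p : X × X, (dist p.1 x₀ ^ 2 + dist p.2 x₀ ^ 2) ∂π
      = ∫ x, dist x x₀ ^ 2 ∂μ + ∫ x, dist x x₀ ^ 2 ∂ν := by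
  obtain ⟨h1, h2⟩ := hπ
  subst h1 h2
  rw [integral_map measurable_fst.aemeasurable hμ.aestronglyMeasurable,
    integral_map measurable_snd.aemeasurable hν.aestronglyMeasurable]
  exact integral_add (hμ.comp_measurable measurable_fst) (hν.comp_measurable measurable_snd)

lemma W2sq_ne_top_of_mem_plans [BorelSpace X] [SecondCountableTopology X] {μ ν : Measure X}
    {π : Measure (X × X)} (hπ : π ∈ plans μ ν) {x₀ : X}
    (hμ : Integrable (fun x => dist x x₀ ^ 2) μ) (hν : Integrable (fun x => dist x x₀ ^ 2) ν) :
    W2sq dist μ ν ≠ ∞ := by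
  have hint : Integrable (fun p : X × X => dist p.1 p.2 ^ 2) π := by
    refine ((integrable_add_sq_dist hπ hμ hν).const_mul 2).mono'
      (Continuous.measurable (by fun_prop)).aestronglyMeasurable (ae_of_all _ fun p => ?_)
    rw [Real.norm_eq_abs, abs_of_nonneg (by positivity)]
    exact sq_dist_le _ _ _
  refine ne_top_of_le_ne_top ?_ (iInf₂_le π hπ : W2sq dist μ ν ≤ cost dist π)
  rw [cost, ← ofReal_integral_eq_lintegral_ofReal hint (ae_of_all _ fun p => sq_nonneg _)]
  exact ENNReal.ofReal_ne_top

end Moments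

/-! ## The convexity inequality in the extended reals -/

section Convexity

/-- Finiteness of `W` makes the distance term real, so it cannot cancel `⊤` whatever the sign of
`k`. -/
lemma convexity_bound_eq_top {a b : EReal} (ha : a ≠ ⊥) (hb : b ≠ ⊥) (hab : a = ⊤ ∨ b = ⊤)
    {s t k : ℝ} (hs : 0 < s) (ht : 0 < t) {W : ℝ≥0∞} (hW : W ≠ ∞) :
    (s : EReal) * a + (t : EReal) * b - (k : EReal) * (W : EReal) = ⊤ := by
  have hmul {c : EReal} (hc : c ≠ ⊥) {r : ℝ} (hr : 0 < r) : (r : EReal) * c ≠ ⊥ := by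
    induction c with
    | bot => exact absurd rfl hc
    | coe x => rw [← EReal.coe_mul]; exact EReal.coe_ne_bot _
    | top => rw [EReal.coe_mul_top_of_pos hr]; simp
  have hsum : (s : EReal) * a + (t : EReal) * b = ⊤ := by
    rcases hab with rfl | rfl
    · rw [EReal.coe_mul_top_of_pos hs, EReal.top_add_of_ne_bot (hmul hb ht)]
    · rw [EReal.coe_mul_top_of_pos ht, EReal.add_top_of_ne_bot (hmul ha hs)]
  rw [hsum, ← EReal.coe_ennreal_toReal hW, ← EReal.coe_mul, sub_eq_add_neg, ← EReal.coe_neg,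
    EReal.top_add_coe]

lemma EntKConvexAlong.of_forall_mem_Ioo {X : Type*} [TopologicalSpace X] [MeasurableSpace X]
    {δ : X → X → ℝ} {m : Measure X} {K : ℝ} {η : Measure C(I, X)}
    (h : ∀ t : I, 0 < (t : ℝ) → (t : ℝ) < 1 → Ent m (η.map (ev t)) ≤
      ((1 - (t : ℝ) : ℝ) : EReal) * Ent m (η.map (ev 0)) +
        ((t : ℝ) : EReal) * Ent m (η.map (ev 1)) -
        ((K / 2 * (t : ℝ) * (1 - (t : ℝ)) : ℝ) : EReal) *
          ((W2sq δ (η.map (ev 0)) (η.map (ev 1)) : ℝ≥0∞) : EReal)) :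
    EntKConvexAlong δ m K η := by
  intro t
  rcases t.2.1.eq_or_lt with h0 | h0
  · obtain rfl : t = 0 := Subtype.ext h0.symm
    simp
  rcases t.2.2.eq_or_lt with h1 | h1
  · obtain rfl : t = 1 := Subtype.ext h1
    simp
  exact h t h0 h1

end Convexity

open InformationTheory

/-! ## Reference measures -/

section ReferenceMeasure

variable {X : Type*} [PseudoMetricSpace X] [MeasurableSpace X] {m : Measure X}

lemma IsReferenceMeasure.sigmaFinite [SecondCountableTopology X] (hm : IsReferenceMeasure m) :
    SigmaFinite m := by
  have : IsLocallyFiniteMeasure m := ⟨fun x => ⟨Metric.ball x 1, Metric.ball_mem_nhds x one_pos,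
    hm.finite_on_bounded _ Metric.isBounded_ball⟩⟩
  infer_instance

/-- The entropy is the relative entropy with respect to a finite measure, up to a second moment. -/
lemma IsReferenceMeasure.exists_Ent_eq [SecondCountableTopology X] [BorelSpace X]
    (hm : IsReferenceMeasure m) : ∃ (x₀ : X) (c b : ℝ) (ν : Measure X), IsFiniteMeasure ν ∧
      ∀ (μ : Measure X) [IsProbabilityMeasure μ], Integrable (fun x => dist x x₀ ^ 2) μ →
        Ent m μ = (klDiv μ ν : EReal) + ((b - c * ∫ x, dist x x₀ ^ 2 ∂μ : ℝ) : EReal) := by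
  obtain ⟨c, hc, x₀, hfin⟩ := hm.growth
  have := hm.sigmaFinite
  have hν : IsFiniteMeasure
      (m.withDensity fun x => ENNReal.ofReal (Real.exp (-(c * dist x x₀ ^ 2)))) :=
    isFiniteMeasure_withDensity hfin.ne
  refine ⟨x₀, c, 1 - (m.withDensity fun x =>
    ENNReal.ofReal (Real.exp (-(c * dist x x₀ ^ 2)))).real Set.univ, _, hν, fun μ _ hμ => ?_⟩
  rw [Ent_eq_klDiv_add (φ := fun x => c * dist x x₀ ^ 2) (Continuous.measurable (by fun_prop))
    (fun x => by positivity) (hμ.const_mul c), integral_const_mul]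

lemma IsReferenceMeasure.Ent_ne_bot [SecondCountableTopology X] [BorelSpace X]
    (hm : IsReferenceMeasure m) {μ : Measure X} [IsProbabilityMeasure μ]
    (hμ : ∃ x₁ : X, ∫⁻ x, ENNReal.ofReal (dist x x₁ ^ 2) ∂μ < ∞) : Ent m μ ≠ ⊥ := by
  obtain ⟨x₀, c, b, ν, -, h⟩ := hm.exists_Ent_eq
  rw [h μ (integrable_sq_dist hμ x₀)]
  simp only [ne_eq, EReal.add_eq_bot_iff, EReal.coe_ennreal_ne_bot, EReal.coe_ne_bot, or_self,
    not_false_eq_true]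

lemma coe_klDiv_add_le_iff {k : ℝ≥0∞} {a r : ℝ} :
    (k : EReal) + (a : EReal) ≤ (r : EReal) ↔ k ≠ ∞ ∧ k.toReal ≤ r - a := by
  rcases eq_or_ne k ∞ with rfl | hk
  · simp
  · rw [← EReal.coe_ennreal_toReal hk, ← EReal.coe_add, EReal.coe_le_coe_iff, le_sub_iff_add_le]
    simp [hk]

end ReferenceMeasure

/-! ### Auxiliary facts on locally uniform limits, push-forwards and densities. -/

lemma TendstoLocallyUniformly.sq {Z : Type*} [TopologicalSpace Z] {u : ℕ → Z → ℝ} {w : Z → ℝ}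
    (h : TendstoLocallyUniformly u w atTop) (hw : Continuous w) :
    TendstoLocallyUniformly (fun n z => u n z ^ 2) (fun z => w z ^ 2) atTop := by
  simp only [pow_two]
  exact h.mul₀ h hw hw

lemma tendstoLocallyUniformly_subseq {Z : Type*} [TopologicalSpace Z] {u : ℕ → Z → ℝ} {w : Z → ℝ}
    (h : TendstoLocallyUniformly u w atTop) {φ : ℕ → ℕ} (hφ : StrictMono φ) :
    TendstoLocallyUniformly (fun n => u (φ n)) w atTop := fun s hs x => by
  obtain ⟨t, ht, h'⟩ := h s hs x
  exact ⟨t, ht, hφ.tendsto_atTop.eventually h'⟩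

lemma map_map_ev {X : Type*} [TopologicalSpace X] [MeasurableSpace X] [BorelSpace X]
    {G : X × X → C(I, X)} (hG : Measurable G) (t : I) (π : Measure (X × X)) :
    (π.map G).map (ev t) = π.map (flowAt G t) :=
  Measure.map_map (continuous_ev t).measurable hG

lemma map_withDensity_comp {Y Z : Type*} [MeasurableSpace Y] [MeasurableSpace Z] {G : Y → Z}
    (hG : Measurable G) (P : Measure Y) {f : Z → ℝ≥0∞} (hf : Measurable f) :
    (P.map G).withDensity f = (P.withDensity fun p => f (G p)).map G := by
  ext s hs
  rw [withDensity_apply _ hs, Measure.map_apply hG hs, withDensity_apply _ (hG hs),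
    setLIntegral_map hs hf hG]

lemma flowAt_zero {X : Type*} [TopologicalSpace X] [MeasurableSpace X] {δ : X → X → ℝ}
    {G : X × X → C(I, X)} (hG : IsConsistentGeodesicFlow δ G) :
    flowAt G 0 = Prod.fst := funext fun p => hG.start p.1 p.2

lemma flowAt_one {X : Type*} [TopologicalSpace X] [MeasurableSpace X] {δ : X → X → ℝ}
    {G : X × X → C(I, X)} (hG : IsConsistentGeodesicFlow δ G) :
    flowAt G 1 = Prod.snd := funext fun p => hG.finish p.1 p.2

/-! ## Stability of the convexity of the entropy -/

section Stability

variable {X : Type*} [MetricSpace X] [SecondCountableTopology X] [LocallyCompactSpace X]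
  [MeasurableSpace X] [BorelSpace X]

theorem entKConvexAlong_of_tendsto {m : Measure X} (hm : IsReferenceMeasure m) {K H L : ℝ}
    {δ : ℕ → X → X → ℝ} (hδ : ∀ n, IsCompatibleDist (δ n))
    (hlim : TendstoLocallyUniformly (fun (n : ℕ) (p : X × X) => δ n p.1 p.2)
      (fun p : X × X => dist p.1 p.2) atTop)
    (hle : ∀ n x y, δ n x y ≤ H * dist x y)
    {G : X × X → C(I, X)} (hG : IsConsistentGeodesicFlow dist G) (hL : IsLipschitzFlow dist L G)
    {μ ν : Pac m} {π : ℕ → ProbabilityMeasure (X × X)} {P : ProbabilityMeasure (X × X)}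
    (hπ : ∀ n, (π n : Measure (X × X)) ∈ optPlans (δ n) (μ.1 : Measure X) (ν.1 : Measure X))
    (hP : (P : Measure (X × X)) ∈ optPlans dist (μ.1 : Measure X) (ν.1 : Measure X))
    (hπP : Tendsto π atTop (𝓝 P))
    (hconv : ∀ n, EntKConvexAlong (δ n) m K ((π n : Measure (X × X)).map G)) :
    EntKConvexAlong dist m K ((P : Measure (X × X)).map G) := by
  obtain ⟨x₀, c, b, ρ, hρ, hEnt⟩ := hm.exists_Ent_eq
  have hμ := integrable_sq_dist μ.2.2 x₀
  have hν := integrable_sq_dist ν.2.2 x₀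
  have hFc (t : I) : Continuous (flowAt G t) := hL.continuous_flowAt t
  have hFm (t : I) : Measurable (flowAt G t) := (hFc t).measurable
  have hends {Q : Measure (X × X)} (hQ : Q ∈ plans (μ.1 : Measure X) (ν.1 : Measure X)) :
      (Q.map G).map (ev 0) = μ.1 ∧ (Q.map G).map (ev 1) = ν.1 := by
    rw [map_map_ev hG.measurable, map_map_ev hG.measurable, flowAt_zero hG, flowAt_one hG]
    exact hQ
  let q : X × X → ℝ := fun p => dist p.1 x₀ ^ 2 + dist p.2 x₀ ^ 2
  have hqc : Continuous q := by fun_prop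
  have hqint {Q : Measure (X × X)} (hQ : Q ∈ plans (μ.1 : Measure X) (ν.1 : Measure X)) :
      Integrable q Q := integrable_add_sq_dist hQ hμ hν
  have hqeq (n : ℕ) : ∫ p, q p ∂(π n : Measure (X × X)) = ∫ p, q p ∂(P : Measure (X × X)) := by
    rw [integral_add_sq_dist (hπ n).1 hμ hν, integral_add_sq_dist hP.1 hμ hν]
  refine EntKConvexAlong.of_forall_mem_Ioo fun t ht0 ht1 => ?_
  rw [(hends hP.1).1, (hends hP.1).2]
  by_cases htop : Ent m μ.1 = ⊤ ∨ Ent m ν.1 = ⊤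
  · rw [convexity_bound_eq_top (hm.Ent_ne_bot μ.2.2) (hm.Ent_ne_bot ν.2.2) htop
      (sub_pos.2 ht1) ht0 (W2sq_ne_top_of_mem_plans hP.1 hμ hν)]
    exact le_top
  push Not at htop
  obtain ⟨a₀, ha₀⟩ : ∃ a : ℝ, Ent m μ.1 = (a : EReal) :=
    ⟨_, (EReal.coe_toReal htop.1 (hm.Ent_ne_bot μ.2.2)).symm⟩
  obtain ⟨a₁, ha₁⟩ : ∃ a : ℝ, Ent m ν.1 = (a : EReal) :=
    ⟨_, (EReal.coe_toReal htop.2 (hm.Ent_ne_bot ν.2.2)).symm⟩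
  -- the transport costs
  have hδ_bound (n : ℕ) (p : X × X) : δ n p.1 p.2 ^ 2 ≤ 2 * H ^ 2 * q p := by
    have h1 := pow_le_pow_left₀ ((hδ n).nonneg p.1 p.2) (hle n p.1 p.2) 2
    have h2 := mul_le_mul_of_nonneg_left (sq_dist_le p.1 p.2 x₀) (sq_nonneg H)
    rw [mul_pow] at h1
    simp only [q]
    linarith
  have hδc (n : ℕ) : Continuous fun p : X × X => δ n p.1 p.2 ^ 2 := (hδ n).continuous.pow 2
  have hcost_lim : Tendsto (fun n => ∫ p, δ n p.1 p.2 ^ 2 ∂(π n : Measure (X × X))) atTop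
      (𝓝 (∫ p, dist p.1 p.2 ^ 2 ∂(P : Measure (X × X)))) := by
    refine tendsto_integral_of_tendstoLocallyUniformly hπP hδc
      (hqc.const_mul (2 * H ^ 2)) (TendstoLocallyUniformly.sq hlim continuous_dist)
      (fun n p => ?_) ((hqint hP.1).const_mul _) (fun n => (hqint (hπ n).1).const_mul _)
      fun n => ?_
    · rw [abs_of_nonneg (sq_nonneg _)]
      exact hδ_bound n p
    · rw [integral_const_mul, integral_const_mul, hqeq]
  have hcost_n (n : ℕ) := coe_W2sq_eq_integral (hπ n)
    (((hqint (hπ n).1).const_mul (2 * H ^ 2)).mono' (hδc n).measurable.aestronglyMeasurable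
      (ae_of_all _ fun p => by
        rw [Real.norm_eq_abs, abs_of_nonneg (sq_nonneg _)]
        exact hδ_bound n p))
  have hcost_P := coe_W2sq_eq_integral hP
    (((hqint hP.1).const_mul 2).mono'
      (Continuous.measurable (by fun_prop)).aestronglyMeasurable
      (ae_of_all _ fun p => by
        rw [Real.norm_eq_abs, abs_of_nonneg (sq_nonneg _)]
        exact sq_dist_le _ _ _))
  -- the second moments at time `t`
  have hF_bound (p : X × X) : dist (flowAt G t p) x₀ ^ 2 ≤ L ^ 2 * q p :=
    sq_dist_flowAt_le hG hL t p x₀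
  have hFdc : Continuous fun p => dist (flowAt G t p) x₀ ^ 2 :=
    ((hFc t).dist continuous_const).pow 2
  have hF_int {Q : Measure (X × X)} (hQ : Q ∈ plans (μ.1 : Measure X) (ν.1 : Measure X)) :
      Integrable (fun p => dist (flowAt G t p) x₀ ^ 2) Q :=
    ((hqint hQ).const_mul (L ^ 2)).mono' hFdc.measurable.aestronglyMeasurable
      (ae_of_all _ fun p => by
        rw [Real.norm_eq_abs, abs_of_nonneg (sq_nonneg _)]
        exact hF_bound p)
  -- The moment enters the entropy with the factor `-c`, so lower semicontinuity would not suffice: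
  -- the moments must really converge.
  have hmom_lim : Tendsto (fun n => ∫ p, dist (flowAt G t p) x₀ ^ 2 ∂(π n : Measure (X × X)))
      atTop (𝓝 (∫ p, dist (flowAt G t p) x₀ ^ 2 ∂(P : Measure (X × X)))) := by
    refine tendsto_integral_of_tendstoLocallyUniformly hπP (fun _ => hFdc)
      (hqc.const_mul (L ^ 2)) (fun s hs x => ⟨Set.univ, univ_mem, Eventually.of_forall
        fun n y _ => refl_mem_uniformity hs⟩)
      (fun n p => ?_) ((hqint hP.1).const_mul _) (fun n => (hqint (hπ n).1).const_mul _)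
      fun n => ?_
    · rw [abs_of_nonneg (sq_nonneg _)]
      exact hF_bound p
    · rw [integral_const_mul, integral_const_mul, hqeq]
  have hsq_sm (Q : Measure (X × X)) :
      AEStronglyMeasurable (fun x => dist x x₀ ^ 2) (Q.map (flowAt G t)) :=
    (Continuous.measurable (by fun_prop)).aestronglyMeasurable
  have hEnt_flow (Q : ProbabilityMeasure (X × X))
      (hQ : (Q : Measure (X × X)) ∈ plans (μ.1 : Measure X) (ν.1 : Measure X)) :
      Ent m (((Q : Measure (X × X)).map G).map (ev t)) =
        (klDiv ((Q : Measure (X × X)).map (flowAt G t)) ρ : EReal) +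
        ((b - c * ∫ p, dist (flowAt G t p) x₀ ^ 2 ∂(Q : Measure (X × X)) : ℝ) : EReal) := by
    have := Measure.isProbabilityMeasure_map (μ := (Q : Measure (X × X))) (hFm t).aemeasurable
    rw [map_map_ev hG.measurable, hEnt _ ((integrable_map_measure (hsq_sm _)
      (hFm t).aemeasurable).2 (hF_int hQ)), integral_map (hFm t).aemeasurable (hsq_sm _)]
  set A : ℝ := (1 - t) * a₀ + t * a₁ with hA
  let κ : ℝ := K / 2 * t * (1 - t)
  have hbound_coe (w : ℝ) : ((1 - (t : ℝ) : ℝ) : EReal) * (a₀ : EReal) + ((t : ℝ) : EReal) * a₁ -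
      (κ : EReal) * (w : EReal) = ((A - κ * w : ℝ) : EReal) := by
    simp only [hA, EReal.coe_sub, EReal.coe_add, EReal.coe_mul]
  rw [ha₀, ha₁, hcost_P, hbound_coe, hEnt_flow P hP.1, coe_klDiv_add_le_iff]
  have happrox (n : ℕ) : klDiv ((π n : Measure (X × X)).map (flowAt G t)) ρ ≠ ∞ ∧
      (klDiv ((π n : Measure (X × X)).map (flowAt G t)) ρ).toReal ≤
        A - κ * ∫ p, δ n p.1 p.2 ^ 2 ∂(π n : Measure (X × X)) -
          (b - c * ∫ p, dist (flowAt G t p) x₀ ^ 2 ∂(π n : Measure (X × X))) := by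
    have h := hconv n t
    rwa [(hends (hπ n).1).1, (hends (hπ n).1).2, ha₀, ha₁, hcost_n n, hbound_coe,
      hEnt_flow (π n) (hπ n).1, coe_klDiv_add_le_iff] at h
  -- For fixed `g` the easy half of the duality holds along `π n`, and every term converges; the
  -- hard half then takes the supremum over `g`.
  have hdual (g : BoundedContinuousFunction X ℝ) :
      ∫ x, g x ∂((P : Measure (X × X)).map (flowAt G t)) - ∫ x, (Real.exp (g x) - 1) ∂ρ ≤
        A - κ * ∫ p, dist p.1 p.2 ^ 2 ∂(P : Measure (X × X)) -
          (b - c * ∫ p, dist (flowAt G t p) x₀ ^ 2 ∂(P : Measure (X × X))) := by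
    have hint (Q : Measure (X × X)) :
        ∫ x, g x ∂(Q.map (flowAt G t)) = ∫ p, g (flowAt G t p) ∂Q :=
      integral_map (hFm t).aemeasurable g.continuous.measurable.aestronglyMeasurable
    have hg_lim := (ProbabilityMeasure.tendsto_iff_forall_integral_tendsto.1 hπP)
      (g.compContinuous ⟨flowAt G t, hFc t⟩)
    rw [hint]
    refine le_of_tendsto_of_tendsto' (hg_lim.sub_const _)
      ((hcost_lim.const_mul κ).const_sub A |>.sub ((hmom_lim.const_mul c).const_sub b))
      fun n => le_trans ?_ (happrox n).2
    have hprob := Measure.isProbabilityMeasure_map (μ := (π n : Measure (X × X)))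
      (hFm t).aemeasurable
    have := integral_sub_integral_exp_le_toReal_klDiv (happrox n).1 g.continuous.measurable
      (N := ‖g‖) g.norm_coe_le_norm
    rwa [hint] at this
  have hprob := Measure.isProbabilityMeasure_map (μ := (P : Measure (X × X))) (hFm t).aemeasurable
  have hkl := klDiv_le_of_forall_boundedContinuous hdual
  refine ⟨ne_top_of_le_ne_top ENNReal.ofReal_ne_top hkl, ENNReal.toReal_le_of_le_ofReal ?_ hkl⟩
  -- Testing with `g = 0` shows that the real upper bound is nonnegative, as
  -- `ENNReal.toReal_le_of_le_ofReal` requires.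
  simpa using hdual 0

end Stability

/-! ## The very strict condition from a consistent plan selection -/

section Selection

variable {X : Type*} [MetricSpace X] [MeasurableSpace X] [BorelSpace X] {m : Measure X}
  {G : X × X → C(I, X)} {L : ℝ}

lemma isOptGeo_map_flow (hG : IsConsistentGeodesicFlow dist G) {μ ν : Measure X}
    {P : Measure (X × X)} (hP : P ∈ optPlans dist μ ν) : IsOptGeo dist μ ν (P.map G) := by
  refine ⟨?_, ?_⟩
  · rw [ae_map_iff hG.measurable.aemeasurable measurableSet_isGeo]
    exact ae_of_all _ fun p => hG.isGeo p.1 p.2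
  · rw [Measure.map_map ((continuous_ev 0).measurable.prodMk (continuous_ev 1).measurable)
      hG.measurable, show (fun γ : C(I, X) => (ev 0 γ, ev 1 γ)) ∘ G = id from
        funext fun p => Prod.ext (hG.start p.1 p.2) (hG.finish p.1 p.2), Measure.map_id]
    exact hP

lemma map_restr_map_flow (hG : IsConsistentGeodesicFlow dist G) (hL : IsLipschitzFlow dist L G)
    {s t : I} (hst : s < t) (Q : Measure (X × X)) :
    (Q.map G).map (restr s t) = (Q.map fun p => (flowAt G s p, flowAt G t p)).map G := by
  rw [Measure.map_map (continuous_restr s t).measurable hG.measurable,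
    Measure.map_map hG.measurable ((hG.measurable_flowAt s).prodMk (hG.measurable_flowAt t))]
  exact congrArg (Q.map ·) (funext fun p => restr_flow_eq hG hL hst p)

/-- A bounded density multiplies second moments by at most `C`, so for membership in `Pac m` only
absolute continuity can fail. -/
lemma exists_lintegral_sq_dist_map_flowAt_lt_top (hG : IsConsistentGeodesicFlow dist G)
    (hL : IsLipschitzFlow dist L G) {μ ν : Pac m} {P : Measure (X × X)}
    (hP : P ∈ plans (μ.1 : Measure X) (ν.1 : Measure X)) {f : X × X → ℝ≥0} (hf : Measurable f)
    {C : ℝ≥0} (hC : ∀ p, f p ≤ C) (t : I) :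
    ∃ x₀ : X, ∫⁻ x, ENNReal.ofReal (dist x x₀ ^ 2)
      ∂((P.withDensity fun p => (f p : ℝ≥0∞)).map (flowAt G t)) < ∞ := by
  obtain ⟨x₀, -⟩ := μ.2.2
  refine ⟨x₀, ?_⟩
  have hint := (integrable_add_sq_dist hP (integrable_sq_dist μ.2.2 x₀)
    (integrable_sq_dist ν.2.2 x₀)).const_mul (L ^ 2)
  have hfin := hint.lintegral_lt_top
  have hdist : Measurable fun x : X => ENNReal.ofReal (dist x x₀ ^ 2) :=
    Measurable.ennreal_ofReal (Continuous.measurable (by fun_prop))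
  have hdistF : Measurable fun p => ENNReal.ofReal (dist (flowAt G t p) x₀ ^ 2) :=
    hdist.comp (hG.measurable_flowAt t)
  rw [lintegral_map hdist (hG.measurable_flowAt t),
    lintegral_withDensity_eq_lintegral_mul _ hf.coe_nnreal_ennreal hdistF]
  calc _ ≤ ∫⁻ p : X × X, C * ENNReal.ofReal (L ^ 2 * (dist p.1 x₀ ^ 2 + dist p.2 x₀ ^ 2)) ∂P := by
        refine lintegral_mono fun p => ?_
        exact mul_le_mul' (ENNReal.coe_le_coe.2 (hC p))
          (ENNReal.ofReal_le_ofReal (sq_dist_flowAt_le hG hL t p x₀))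
    _ < ∞ := by
        rw [lintegral_const_mul' _ _ ENNReal.coe_ne_top]
        exact ENNReal.mul_lt_top ENNReal.coe_lt_top hfin

variable [SecondCountableTopology X]

theorem isVeryStrictCD_of_consistentPlanSelection (hm : IsReferenceMeasure m) {K : ℝ}
    (hG : IsConsistentGeodesicFlow dist G) (hL : IsLipschitzFlow dist L G)
    {Sel : Pac m → Pac m → ProbabilityMeasure (X × X)} (hSel : IsConsistentPlanSelection m G Sel)
    (hconv : ∀ μ ν : Pac m, EntKConvexAlong dist m K ((Sel μ ν : Measure (X × X)).map G)) :
    IsVeryStrictCD m K := by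
  intro μ₀ hμ₀ μ₁ hμ₁
  set P := Sel ⟨μ₀, hμ₀⟩ ⟨μ₁, hμ₁⟩
  have hP := hSel.optimal ⟨μ₀, hμ₀⟩ ⟨μ₁, hμ₁⟩
  refine ⟨P.map hG.measurable.aemeasurable, isOptGeo_map_flow hG hP, ?_⟩
  rintro s t hst f hf ⟨C, hC⟩ hf1
  rw [ProbabilityMeasure.toMeasure_map] at hf1 ⊢
  rw [lintegral_map hf.coe_nnreal_ennreal hG.measurable] at hf1
  have hfG : Measurable fun p => f (G p) := hf.comp hG.measurable
  -- The weight `f` on curves becomes the weight `f ∘ G` on pairs of endpoints, the form required by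
  -- `hSel.consistent`.
  rw [map_withDensity_comp hG.measurable _ hf.coe_nnreal_ennreal, map_restr_map_flow hG hL hst]
  set Q := (P : Measure (X × X)).withDensity fun p => (f (G p) : ℝ≥0∞) with hQdef
  have hQ : IsProbabilityMeasure Q := ⟨by
    rw [hQdef, withDensity_apply _ MeasurableSet.univ, Measure.restrict_univ, hf1]⟩
  have hFm (r : I) := hG.measurable_flowAt r
  have hprob (r : I) : IsProbabilityMeasure (Q.map (flowAt G r)) :=
    Measure.isProbabilityMeasure_map (hFm r).aemeasurable
  have hmom (r : I) : ∃ x₀ : X, ∫⁻ x, ENNReal.ofReal (dist x x₀ ^ 2) ∂(Q.map (flowAt G r)) < ∞ :=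
    exists_lintegral_sq_dist_map_flowAt_lt_top hG hL hP.1 hfG (fun p => hC (G p)) r
  have hpair : Measurable fun p => (flowAt G s p, flowAt G t p) := (hFm s).prodMk (hFm t)
  by_cases hac : Q.map (flowAt G s) ≪ m ∧ Q.map (flowAt G t) ≪ m
  · rw [hSel.consistent ⟨μ₀, hμ₀⟩ ⟨μ₁, hμ₁⟩ s t hst (fun p => f (G p)) hfG ⟨C, fun p => hC (G p)⟩
      hf1 ⟨⟨Q.map (flowAt G s), hprob s⟩, hac.1, hmom s⟩
      ⟨⟨Q.map (flowAt G t), hprob t⟩, hac.2, hmom t⟩ rfl rfl]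
    exact hconv _ _
  -- Here an endpoint has entropy `⊤`, while finite second moments keep the other entropy above `⊥`
  -- and the transport cost finite.
  · refine EntKConvexAlong.of_forall_mem_Ioo fun r hr0 hr1 => ?_
    have hplan : Q.map (fun p => (flowAt G s p, flowAt G t p)) ∈
        plans (Q.map (flowAt G s)) (Q.map (flowAt G t)) :=
      ⟨Measure.map_map measurable_fst hpair, Measure.map_map measurable_snd hpair⟩
    obtain ⟨x₀, -⟩ := hμ₀.2
    rw [map_map_ev hG.measurable 0, map_map_ev hG.measurable 1, flowAt_zero hG, flowAt_one hG,
      hplan.1, hplan.2, convexity_bound_eq_top (hm.Ent_ne_bot (hmom s)) (hm.Ent_ne_bot (hmom t)) ?_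
        (sub_pos.2 hr1) hr0 (W2sq_ne_top_of_mem_plans hplan (integrable_sq_dist (hmom s) x₀)
          (integrable_sq_dist (hmom t) x₀))]
    · exact le_top
    · rcases not_and_or.1 hac with h | h
      · exact .inl (if_neg h)
      · exact .inr (if_neg h)

end Selection

end VeryStrictCD

theorem mainTheorem4 {X : Type*} [MetricSpace X] [CompleteSpace X] [SecondCountableTopology X]
    [LocallyCompactSpace X] [MeasurableSpace X] [BorelSpace X]
    (m : Measure X) (hm : VeryStrictCD.IsReferenceMeasure m)
    (K : ℝ)
    -- distances `d_n` inducing the topology of `X`, converging locally uniformly to `d`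
    (δ : ℕ → X → X → ℝ) (hδ : ∀ n, VeryStrictCD.IsCompatibleDist (δ n))
    (hδ_lim : TendstoLocallyUniformly (fun (n : ℕ) (p : X × X) => δ n p.1 p.2)
      (fun p : X × X => dist p.1 p.2) atTop)
    (H : ℝ) (hδ_le : ∀ n x y, δ n x y ≤ H * dist x y)
    -- one flow for all the distances
    (G : X × X → C(unitInterval, X))
    (hG : VeryStrictCD.IsConsistentGeodesicFlow dist G)
    (hG_lip : ∃ L : ℝ, VeryStrictCD.IsLipschitzFlow dist L G)
    (hGδ : ∀ n, VeryStrictCD.IsConsistentGeodesicFlow (δ n) G)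
    -- a consistent plan selection for `d`, approximated by `d_n`-optimal plans
    (Sel : VeryStrictCD.Pac m → VeryStrictCD.Pac m → ProbabilityMeasure (X × X))
    (hSel : VeryStrictCD.IsConsistentPlanSelection m G Sel)
    (happrox : ∀ μ ν : VeryStrictCD.Pac m, ∃ π : ℕ → ProbabilityMeasure (X × X),
      (∀ n, (π n : Measure (X × X)) ∈
        VeryStrictCD.optPlans (δ n) (μ.1 : Measure X) (ν.1 : Measure X)) ∧
      (∃ φ : ℕ → ℕ, StrictMono φ ∧ Tendsto (fun k => π (φ k)) atTop (𝓝 (Sel μ ν))) ∧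
      (∀ n, VeryStrictCD.EntKConvexAlong (δ n) m K ((π n : Measure (X × X)).map G))) :
    VeryStrictCD.IsVeryStrictCD m K := by
  obtain ⟨L, hL⟩ := hG_lip
  refine VeryStrictCD.isVeryStrictCD_of_consistentPlanSelection hm hG hL hSel fun μ ν => ?_
  obtain ⟨π, hπ, ⟨φ, hφ, hlim⟩, hconv⟩ := happrox μ ν
  exact VeryStrictCD.entKConvexAlong_of_tendsto hm (fun n => hδ (φ n))
    (VeryStrictCD.tendstoLocallyUniformly_subseq hδ_lim hφ) (fun n => hδ_le (φ n)) hG hL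
    (fun n => hπ (φ n)) (hSel.optimal μ ν) hlim fun n => hconv (φ n)
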